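/- Let $K$ be a number field and let $f\in K[z]$ be a polynomial of degree $d\ge 2$ that is post-critically finite (PCF), i.e. every critical point of $f$ in $\overline K$ (every root of $f'$) has a finite forward orbit under $f$. For $\alpha\in K$ and $n\ge 0$ let $f^n$ be the $n$-th iterate of $f$, and let $\mathrm{Gal}_f^n(\alpha)$ be the Galois group over $K$ of the splitting field of $f^n(z)-\alpha$. Let $[S_d]^n$ be the $n$-fold iterated wreath product of the symmetric group $S_d$ acting on $d$ letters, i.e. $[S_d]^0=1$ and $[S_d]^{n+1}=[S_d]^n\wr S_d$. Let $T_\infty$ be the tree of iterated preimages of $\alpha$: its root is $\alpha$, and the children of a vertex carrying the point $x\in\overline K$ are the $d$ roots of $f(z)-x$ in $\overline K$, where multiple roots are counted as different vertices. It is isomorphic to the infinite rooted $d$-ary tree $T_\infty(d)$. The group $\mathrm{Gal}(\overline K/K)$ acts on $T_\infty$ by automorphisms ($\sigma$ sends the $i$-th copy of a root $y$ to the $i$-th copy of $\sigma(y)$). Let $\mathrm{Gal}_f^\infty(\alpha)\le \mathrm{Aut}(T_\infty(d))=[S_d]^\infty$ be the image of this action under any identification $T_\infty\cong T_\infty(d)$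 of rooted trees. Then: 1. There exists an integer $N\ge 0$ such that for every $\alpha\in K$ the group $\mathrm{Gal}_f^N(\alpha)$ is not isomorphic to $[S_d]^N$. 2. For every $\alpha\in K$, the index $[\mathrm{Aut}(T_\infty(d)):\mathrm{Gal}_f^\infty(\alpha)]$ is infinite. -/

import Mathlib

open Polynomial

namespace Arboreal

noncomputable section

/-! ### Dynamical Galois groups and post-critically finite polynomials -/

/-- The `n`-th iterate `f ∘ ⋯ ∘ f` of a polynomial; the `0`-th iterate is `X`. -/
def iter {K : Type*} [Field K] (f : K[X]) (n : ℕ) : K[X] := f.comp^[n] X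

/-- The `n`-th dynamical Galois group: the Galois group over `K` of the splitting field of
`f^n(z) - α`. -/
abbrev DynGal {K : Type*} [Field K] (f : K[X]) (α : K) (n : ℕ) : Type _ :=
  (iter f n - C α).Gal

/-- `f` is post-critically finite: every (finite) critical point of `f`, in an algebraic closure
of `K`, has a finite forward orbit under `f`. -/
def IsPCF {K : Type*} [Field K] (f : K[X]) : Prop :=
  ∀ c : AlgebraicClosure K, aeval c (derivative f) = 0 →
    (Set.range fun n : ℕ => (fun z : AlgebraicClosure K => aeval z f)^[n] c).Finite

/-! ### Iterated wreath products of symmetric groups -/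

/-- The wreath product `H ≀ S_d`, where `S_d` permutes the `d` coordinates of `H ^ d`. -/
abbrev Wreath (H : Type) [Group H] (d : ℕ) : Type :=
  (Fin d → H) ⋊[mulAutArrow] Equiv.Perm (Fin d)

/-- Auxiliary recursion for the iterated wreath product: the underlying type with its group
structure. -/
def iterWreathAux (d : ℕ) : ℕ → Σ G : Type, Group G
  | 0 => ⟨Unit, inferInstance⟩
  | n + 1 =>
    letI := (iterWreathAux d n).2
    ⟨Wreath (iterWreathAux d n).1 d, inferInstance⟩

/-- The `n`-fold wreath product `[S_d]^n`: `[S_d]^0` is trivial, and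
`[S_d]^(n+1) = [S_d]^n ≀ S_d`. -/
def IterWreath (d n : ℕ) : Type := (iterWreathAux d n).1

instance (d n : ℕ) : Group (IterWreath d n) := (iterWreathAux d n).2

/-! ### Automorphisms of rooted trees -/

/-- The automorphism group of a rooted tree with vertex set `V`, given by its parent map `p`
(the root being its own parent): the permutations of `V` that commute with `p`. Such a permutation
fixes the root and preserves edges, and conversely. -/
def treeAut {V : Type*} (p : V → V) : Subgroup (Equiv.Perm V) where
  carrier := {σ | ∀ v, σ (p v) = p (σ v)}
  one_mem' := fun _ => rfl
  mul_mem' := by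
    intro σ τ hσ hτ v
    rw [Equiv.Perm.mul_apply, Equiv.Perm.mul_apply, hτ, hσ]
  inv_mem' := by
    intro σ hσ v
    rw [Equiv.Perm.inv_eq_iff_eq, hσ]
    exact congrArg p (σ.apply_symm_apply v).symm

/-- `Aut(T_∞(d))`. The vertices of the infinite `d`-ary tree `T_∞(d)` are the finite words
`[l_m, …, l_1]` in `d` letters; the root is the empty word, and the parent of `[l_m, …, l_1]` is
`[l_{m-1}, …, l_1]`. -/
abbrev AutTree (d : ℕ) : Subgroup (Equiv.Perm (List (Fin d))) := treeAut List.tail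

/-! ### The tree of iterated preimages of `α` -/

section Preimages

variable {K : Type*} [Field K]

/-- The point of the algebraic closure carried by a vertex: `α` at the root, and `y` at a vertex
whose last step is to a (copy of a) preimage `y`. -/
def point (α : K) : List (AlgebraicClosure K × ℕ) → AlgebraicClosure K
  | [] => algebraMap K (AlgebraicClosure K) α
  | p :: _ => p.1

/-- A vertex at level `m` is a word `[(y_m, i_m), …, (y_1, i_1)]` where `y_k` is a root of
`f(z) - y_{k-1}` (with `y_0 = α`) and `i_k` is smaller than its multiplicity, so that multiple
roots count as different elements. -/
def IsVertex (f : K[X]) (α : K) : List (AlgebraicClosure K × ℕ) → Prop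
  | [] => True
  | p :: w => IsVertex f α w ∧
      p.2 < rootMultiplicity p.1 (f.map (algebraMap K (AlgebraicClosure K)) - C (point α w))

/-- The vertices of the infinite tree of iterated preimages of `α` under `f`. -/
def PreimageTree (f : K[X]) (α : K) : Type _ :=
  {w : List (AlgebraicClosure K × ℕ) // IsVertex f α w}

theorem IsVertex.tail {f : K[X]} {α : K} {w : List (AlgebraicClosure K × ℕ)}
    (h : IsVertex f α w) : IsVertex f α w.tail := by
  cases w with
  | nil => exact h
  | cons p w => exact h.1

/-- The parent of a vertex; there is an edge between the vertex `y` and its parent `f(y)`. -/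
def parent {f : K[X]} {α : K} (v : PreimageTree f α) : PreimageTree f α :=
  ⟨v.1.tail, v.2.tail⟩

/-- The action of a Galois automorphism on words. -/
def galWord (σ : Gal(AlgebraicClosure K/K)) (w : List (AlgebraicClosure K × ℕ)) :
    List (AlgebraicClosure K × ℕ) :=
  w.map fun p => (σ p.1, p.2)

theorem point_galWord (α : K) (σ : Gal(AlgebraicClosure K/K))
    (w : List (AlgebraicClosure K × ℕ)) : point α (galWord σ w) = σ (point α w) := by
  cases w with
  | nil => exact (σ.commutes α).symm
  | cons p w => rfl

theorem IsVertex.galWord {f : K[X]} {α : K} (σ : Gal(AlgebraicClosure K/K))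
    {w : List (AlgebraicClosure K × ℕ)} (h : IsVertex f α w) :
    IsVertex f α (galWord σ w) := by
  induction w with
  | nil => trivial
  | cons p w ih =>
    refine ⟨ih h.1, ?_⟩
    change p.2 < rootMultiplicity (σ p.1)
      (f.map (algebraMap K (AlgebraicClosure K)) - C (point α (Arboreal.galWord σ w)))
    rw [point_galWord]
    have key : f.map (algebraMap K (AlgebraicClosure K)) - C (σ (point α w)) =
        (f.map (algebraMap K (AlgebraicClosure K)) - C (point α w)).map
          (σ : AlgebraicClosure K ≃+* AlgebraicClosure K).toRingHom := by
      rw [Polynomial.map_sub, map_C, Polynomial.map_map]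
      congr 2
      ext x
      exact (σ.commutes x).symm
    have := h.2
    rw [eq_rootMultiplicity_map
      (f := (σ : AlgebraicClosure K ≃+* AlgebraicClosure K).toRingHom) σ.injective] at this
    rw [key]
    exact this

/-- The action of the absolute Galois group of `K` on the tree of iterated preimages of `α`:
`σ` sends the `i`-th copy of the root `y` to the `i`-th copy of the root `σ y`. -/
def galPerm (f : K[X]) (α : K) :
    Gal(AlgebraicClosure K/K) →* Equiv.Perm (PreimageTree f α) where
  toFun σ :=
    { toFun := fun v => ⟨galWord σ v.1, v.2.galWord σ⟩
      invFun := fun v => ⟨galWord σ⁻¹ v.1, v.2.galWord σ⁻¹⟩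
      left_inv := fun v => Subtype.ext (by
        simp only [galWord, List.map_map]
        refine (List.map_congr_left fun p _ => ?_).trans (List.map_id v.1)
        exact Prod.ext (σ.symm_apply_apply p.1) rfl)
      right_inv := fun v => Subtype.ext (by
        simp only [galWord, List.map_map]
        refine (List.map_congr_left fun p _ => ?_).trans (List.map_id v.1)
        exact Prod.ext (σ.apply_symm_apply p.1) rfl) }
  map_one' := Equiv.ext fun v => Subtype.ext (List.map_id v.1)
  map_mul' σ τ := Equiv.ext fun v => Subtype.ext (by
    change galWord (σ * τ) v.1 = galWord σ (galWord τ v.1)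
    simp only [galWord, List.map_map]
    rfl)

theorem galPerm_parent (f : K[X]) (α : K) (σ : Gal(AlgebraicClosure K/K))
    (v : PreimageTree f α) : galPerm f α σ (parent v) = parent (galPerm f α σ v) :=
  Subtype.ext List.map_tail

/-- A labeling of the tree of iterated preimages of `α` under `f`: an isomorphism of rooted trees
onto `T_∞(d)`, where `d` is the degree of `f`. -/
structure Labeling (f : K[X]) (α : K) where
  /-- The bijection on vertices. -/
  toEquiv : PreimageTree f α ≃ List (Fin f.natDegree)
  map_parent : ∀ v, toEquiv (parent v) = (toEquiv v).tail

/-- The arboreal representation of the absolute Galois group of `K` in `Aut(T_∞(d))`, with respect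
to a labeling of the tree of iterated preimages. -/
def arborealRep {f : K[X]} {α : K} (e : Labeling f α) :
    Gal(AlgebraicClosure K/K) →* AutTree f.natDegree :=
  (e.toEquiv.permCongrHom.toMonoidHom.comp (galPerm f α)).codRestrict _ (by
    intro σ w
    change e.toEquiv (galPerm f α σ (e.toEquiv.symm w.tail)) =
      (e.toEquiv (galPerm f α σ (e.toEquiv.symm w))).tail
    rw [← e.map_parent, ← galPerm_parent]
    congr 2
    rw [Equiv.symm_apply_eq, e.map_parent, Equiv.apply_symm_apply])

/-- `Gal_f^∞(α)`, as a subgroup of `Aut(T_∞(d))`: the image of the arboreal representation. -/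
def arborealImage {f : K[X]} {α : K} (e : Labeling f α) : Subgroup (AutTree f.natDegree) :=
  (arborealRep e).range

/-- The roots of `f(z) - x`, with multiplicity, can be numbered by `0, …, d - 1`. -/
theorem exists_equiv_children (f : K[X]) (x : AlgebraicClosure K) :
    Nonempty (Fin f.natDegree ≃ {p : AlgebraicClosure K × ℕ //
      p.2 < rootMultiplicity p.1 (f.map (algebraMap K (AlgebraicClosure K)) - C x)}) := by
  classical
  set g := f.map (algebraMap K (AlgebraicClosure K)) - C x with hg
  have hdeg : g.natDegree = f.natDegree := by
    rw [hg, natDegree_sub_C, natDegree_map]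
  have hcard : g.roots.card = f.natDegree := by
    rw [← hdeg]
    exact (IsAlgClosed.splits g).natDegree_eq_card_roots.symm
  have e1 : g.roots.ToType ≃ {p : AlgebraicClosure K × ℕ // p.2 < rootMultiplicity p.1 g} :=
    { toFun := fun a => ⟨(a.1, a.2.1), (count_roots g) ▸ a.2.2⟩
      invFun := fun p => ⟨p.1.1, ⟨p.1.2, (count_roots g).symm ▸ p.2⟩⟩
      left_inv := fun _ => rfl
      right_inv := fun _ => rfl }
  have e2 : Fin f.natDegree ≃ g.roots.ToType :=
    (Fintype.equivFinOfCardEq (by rw [Multiset.card_coe, hcard])).symm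
  exact ⟨e2.trans e1⟩

/-- The tree of iterated preimages is always a `d`-ary tree: it has a labeling. -/
theorem nonempty_labeling (f : K[X]) (α : K) :
    Nonempty (Labeling f α) := by
  obtain ⟨φ⟩ : Nonempty (∀ x : AlgebraicClosure K, Fin f.natDegree ≃
      {p : AlgebraicClosure K × ℕ //
        p.2 < rootMultiplicity p.1 (f.map (algebraMap K (AlgebraicClosure K)) - C x)}) :=
    ⟨fun x => (exists_equiv_children f x).some⟩
  let F : List (Fin f.natDegree) → PreimageTree f α := fun w =>
    List.rec ⟨[], trivial⟩
      (fun l _ v => ⟨(φ (point α v.1) l).1 :: v.1, v.2, (φ (point α v.1) l).2⟩) w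
  have hF : ∀ l w, (F (l :: w)).1 = (φ (point α (F w).1) l).1 :: (F w).1 := fun _ _ => rfl
  have hpar : ∀ w, F w.tail = parent (F w) := by
    intro w
    cases w <;> rfl
  have hinj : Function.Injective F := by
    intro w
    induction w with
    | nil =>
      intro w' h
      cases w' with
      | nil => rfl
      | cons l w' => exact absurd (congrArg Subtype.val h) (by rw [hF]; exact (List.cons_ne_nil _ _).symm)
    | cons l w ih =>
      intro w' h
      cases w' with
      | nil => exact absurd (congrArg Subtype.val h) (by rw [hF]; exact List.cons_ne_nil _ _)
      | cons l' w' =>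
        have h' := congrArg Subtype.val h
        rw [hF, hF, List.cons.injEq] at h'
        obtain rfl := ih (Subtype.ext h'.2)
        rw [(φ _).injective (Subtype.ext h'.1)]
  have hsurj : Function.Surjective F := by
    rintro ⟨w, hw⟩
    induction w with
    | nil => exact ⟨[], rfl⟩
    | cons p w ih =>
      obtain ⟨u, hu⟩ := ih hw.1
      have hu' : (F u).1 = w := congrArg Subtype.val hu
      subst hu'
      refine ⟨(φ (point α (F u).1)).symm ⟨p, hw.2⟩ :: u, Subtype.ext ?_⟩
      rw [hF, Equiv.apply_symm_apply]
  let E : List (Fin f.natDegree) ≃ PreimageTree f α := Equiv.ofBijective F ⟨hinj, hsurj⟩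
  have hE : ∀ w, E w.tail = parent (E w) := hpar
  refine ⟨⟨E.symm, fun v => ?_⟩⟩
  rw [Equiv.symm_apply_eq, hE, Equiv.apply_symm_apply]

end Preimages

end

end Arboreal

namespace Arboreal

/-! ### Portraits of tree automorphisms -/

section Portrait

variable {d : ℕ}

/-! The obstruction is a sign. For a vertex `v`, let `levelDet x v k` be the product of the
Vandermonde determinants of the children of all vertices `k` levels below `v`. A Galois automorphism
fixing `v` multiplies it by `levelSign`, the product of the signs of its portrait on that level
(`map_levelDet`). Its square is a product of discriminants, hence up to factors from `K` the product
of `f^(k+1)(c) - x v` over the critical points `c` (`levelDet_sq`). If `f` is PCF, these products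
coincide for infinitely many `k`. For two such levels the leftover factor is a square in `K`, so the
ratio of the determinants lies in `K` and the two signs agree on Galois
(`IsPreimageLabel.levelSign_eq`). In the full automorphism group a transposition at one vertex
changes the sign on one level only.

The argument needs nonzero determinants. A zero means that two children of some vertex are copies of
one multiple root; Galois preserves the index of a copy, so it cannot fix the vertex and act on its
children by swapping these two (`portrait_arborealRep_ne`). Either way some portrait is missed.
Counting turns a missed portrait at bounded depth into the first claim, and infinitely many
independent obstructions give infinite index. -/

theorem autTree_tail (σ : AutTree d) (w : List (Fin d)) :
    σ.1 w.tail = (σ.1 w).tail := σ.2 w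

theorem autTree_nil (σ : AutTree d) : σ.1 [] = [] := by
  have h := autTree_tail σ []
  rcases hσ : σ.1 [] with _ | ⟨l, w⟩
  · rfl
  · rw [List.tail_nil, hσ] at h
    exact absurd (congrArg List.length h) (by simp)

theorem autTree_cons_ne_nil (σ : AutTree d) (l : Fin d) (w : List (Fin d)) :
    σ.1 (l :: w) ≠ [] := by
  rw [← autTree_nil σ]
  exact σ.1.injective.ne (List.cons_ne_nil _ _)

theorem autTree_cons (σ : AutTree d) (l : Fin d) (w : List (Fin d)) :
    σ.1 (l :: w) = (σ.1 (l :: w)).head (autTree_cons_ne_nil σ l w) :: σ.1 w := by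
  conv_rhs => rw [show w = (l :: w).tail from rfl, autTree_tail]
  exact (List.cons_head_tail _).symm

/-- The permutation of the letters that a tree automorphism induces between the children of the
vertex `w` and the children of its image. -/
noncomputable def portrait (σ : AutTree d) (w : List (Fin d)) : Equiv.Perm (Fin d) :=
  Equiv.ofBijective (fun l => (σ.1 (l :: w)).head (autTree_cons_ne_nil σ l w)) <| by
    rw [← Finite.injective_iff_bijective]
    intro l l' h
    have h' : σ.1 (l :: w) = σ.1 (l' :: w) := by
      rw [autTree_cons σ l, autTree_cons σ l']
      exact congrArg (· :: σ.1 w) h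
    exact (List.cons.inj (σ.1.injective h')).1

theorem apply_cons (σ : AutTree d) (l : Fin d) (w : List (Fin d)) :
    σ.1 (l :: w) = portrait σ w l :: σ.1 w :=
  autTree_cons σ l w

theorem portrait_mul (σ τ : AutTree d) (w : List (Fin d)) :
    portrait (σ * τ) w = portrait σ (τ.1 w) * portrait τ w := by
  ext1 l
  have h : (σ * τ).1 (l :: w) = σ.1 (τ.1 (l :: w)) := rfl
  rw [apply_cons, apply_cons τ, apply_cons σ] at h
  exact (List.cons.inj h).1

/-- Automorphisms with the same portrait up to depth `N` agree up to level `N`. -/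
theorem apply_eq_of_portrait_eq {σ τ : AutTree d} {N : ℕ}
    (h : ∀ w : List (Fin d), w.length < N → portrait σ w = portrait τ w) (w : List (Fin d))
    (hw : w.length ≤ N) : σ.1 w = τ.1 w := by
  induction w with
  | nil => rw [autTree_nil, autTree_nil]
  | cons l w ih =>
    rw [List.length_cons] at hw
    rw [apply_cons, apply_cons, ih (by omega), h w (by omega)]

theorem apply_eq_self_of_portrait_eq_one {σ : AutTree d} {N : ℕ}
    (h : ∀ w : List (Fin d), w.length < N → portrait σ w = 1) (w : List (Fin d))
    (hw : w.length ≤ N) : σ.1 w = w := by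
  induction w with
  | nil => rw [autTree_nil]
  | cons l w ih =>
    rw [List.length_cons] at hw
    rw [apply_cons, ih (by omega), h w (by omega), Equiv.Perm.one_apply]

/-- The action on words with prescribed portrait. -/
def portraitAction (p : List (Fin d) → Equiv.Perm (Fin d)) : List (Fin d) → List (Fin d)
  | [] => []
  | l :: w => p w l :: portraitAction p w

/-- The inverse of `portraitAction`. -/
def portraitActionInv (p : List (Fin d) → Equiv.Perm (Fin d)) : List (Fin d) → List (Fin d)
  | [] => []
  | l :: w => (p (portraitActionInv p w)).symm l :: portraitActionInv p w

/-- The tree automorphism with a prescribed portrait. -/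
def ofPortrait (p : List (Fin d) → Equiv.Perm (Fin d)) : AutTree d :=
  ⟨{ toFun := portraitAction p
     invFun := portraitActionInv p
     left_inv := fun w => by
      induction w with
      | nil => rfl
      | cons l w ih => simp [portraitAction, portraitActionInv, ih]
     right_inv := fun w => by
      induction w with
      | nil => rfl
      | cons l w ih => simp [portraitAction, portraitActionInv, ih] }, fun w => by
    cases w <;> rfl⟩

@[simp]
theorem portrait_ofPortrait (p : List (Fin d) → Equiv.Perm (Fin d)) (w : List (Fin d)) :
    portrait (ofPortrait p) w = p w := by
  ext1 l
  have h : (ofPortrait p).1 (l :: w) = p w l :: (ofPortrait p).1 w := rfl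
  rw [apply_cons] at h
  exact (List.cons.inj h).1

/-- The tree automorphism that permutes the children of the vertex `w`, together with the subtrees
under them, by `π`, and fixes everything else. -/
noncomputable def rotate (w : List (Fin d)) (π : Equiv.Perm (Fin d)) : AutTree d :=
  ofPortrait (Function.update 1 w π)

theorem portrait_rotate_self (w : List (Fin d)) (π : Equiv.Perm (Fin d)) :
    portrait (rotate w π) w = π := by
  simp [rotate]

theorem portrait_rotate_of_ne {w u : List (Fin d)} (h : u ≠ w) (π : Equiv.Perm (Fin d)) :
    portrait (rotate w π) u = 1 := by
  simp [rotate, h]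

theorem rotate_apply_of_length_le {w u : List (Fin d)} (h : u.length ≤ w.length)
    (π : Equiv.Perm (Fin d)) : (rotate w π).1 u = u :=
  apply_eq_self_of_portrait_eq_one (N := w.length)
    (fun _ hw => portrait_rotate_of_ne (by rintro rfl; exact lt_irrefl _ hw) π) u h

/-- The descendants of the vertex `v` that lie `k` levels below it. -/
def desc (v : List (Fin d)) : ℕ → Finset (List (Fin d))
  | 0 => {v}
  | k + 1 => (Finset.univ ×ˢ desc v k).map
      ⟨fun p : Fin d × List (Fin d) => p.1 :: p.2, fun _ _ h =>
        Prod.ext (List.cons.inj h).1 (List.cons.inj h).2⟩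

theorem mem_desc_succ {v w : List (Fin d)} {k : ℕ} :
    w ∈ desc v (k + 1) ↔ ∃ l, ∃ u ∈ desc v k, l :: u = w := by
  simp only [desc, Finset.mem_map, Finset.mem_product, Finset.mem_univ, true_and, Prod.exists]
  rfl

theorem cons_mem_desc_succ {v u : List (Fin d)} {l : Fin d} {k : ℕ} :
    l :: u ∈ desc v (k + 1) ↔ u ∈ desc v k := by
  simp [mem_desc_succ]

theorem prod_desc_succ {M : Type*} [CommMonoid M] (v : List (Fin d)) (k : ℕ)
    (F : List (Fin d) → M) :
    ∏ w ∈ desc v (k + 1), F w = ∏ u ∈ desc v k, ∏ l, F (l :: u) := by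
  rw [desc, Finset.prod_map, Finset.prod_product_right]
  rfl

theorem length_of_mem_desc {v w : List (Fin d)} {k : ℕ} (h : w ∈ desc v k) :
    w.length = v.length + k := by
  induction k generalizing w with
  | zero => rw [Finset.mem_singleton.1 h, add_zero]
  | succ k ih =>
    obtain ⟨l, u, hu, rfl⟩ := mem_desc_succ.1 h
    rw [List.length_cons, ih hu, add_assoc]

theorem append_mem_desc (v w : List (Fin d)) : w ++ v ∈ desc v w.length := by
  induction w with
  | nil => exact Finset.mem_singleton_self v
  | cons l w ih => exact cons_mem_desc_succ.2 ih

theorem card_desc (v : List (Fin d)) (k : ℕ) : (desc v k).card = d ^ k := by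
  induction k with
  | zero => simp [desc]
  | succ k ih => rw [desc, Finset.card_map, Finset.card_product, ih]; simp [pow_succ']

theorem apply_mem_desc {σ : AutTree d} {v : List (Fin d)} (hσ : σ.1 v = v) {k : ℕ}
    {w : List (Fin d)} (hw : w ∈ desc v k) : σ.1 w ∈ desc v k := by
  induction k generalizing w with
  | zero =>
    rw [Finset.mem_singleton.1 hw, hσ]
    exact Finset.mem_singleton_self v
  | succ k ih =>
    obtain ⟨l, u, hu, rfl⟩ := mem_desc_succ.1 hw
    rw [apply_cons]
    exact cons_mem_desc_succ.2 (ih hu)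

theorem apply_mem_desc_iff {σ : AutTree d} {v : List (Fin d)} (hσ : σ.1 v = v) {k : ℕ}
    {w : List (Fin d)} : w ∈ desc v k ↔ σ.1 w ∈ desc v k := by
  refine ⟨apply_mem_desc hσ, fun h => ?_⟩
  have := apply_mem_desc (σ := σ⁻¹) (v := v) (σ.1.symm_apply_eq.2 hσ.symm) h
  rwa [show (σ⁻¹).1 (σ.1 w) = w from σ.1.symm_apply_apply w] at this

/-- The product of the signs of the portrait of `σ` over the `k`-th level below `v`. -/
noncomputable def levelSign (σ : AutTree d) (v : List (Fin d)) (k : ℕ) : ℤˣ :=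
  ∏ w ∈ desc v k, Equiv.Perm.sign (portrait σ w)

/-- Since `τ` fixes `v`, it permutes the level below `v`, and the shift by `τ` in `portrait_mul`
disappears in the product. -/
theorem levelSign_mul (σ : AutTree d) {τ : AutTree d} {v : List (Fin d)} (hτ : τ.1 v = v)
    (k : ℕ) : levelSign (σ * τ) v k = levelSign σ v k * levelSign τ v k := by
  simp only [levelSign, portrait_mul, map_mul, Finset.prod_mul_distrib]
  congr 1
  exact Finset.prod_equiv τ.1 (fun _ => apply_mem_desc_iff hτ) fun _ _ => rfl

theorem levelSign_rotate_self {v w : List (Fin d)} {k : ℕ} (hw : w ∈ desc v k)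
    (π : Equiv.Perm (Fin d)) : levelSign (rotate w π) v k = Equiv.Perm.sign π := by
  rw [levelSign, Finset.prod_eq_single_of_mem w hw, portrait_rotate_self]
  intro u _ hu
  rw [portrait_rotate_of_ne hu, map_one]

theorem levelSign_rotate_of_notMem {v w : List (Fin d)} {k : ℕ} (hw : w ∉ desc v k)
    (π : Equiv.Perm (Fin d)) : levelSign (rotate w π) v k = 1 := by
  refine Finset.prod_eq_one fun u hu => ?_
  rw [portrait_rotate_of_ne (by rintro rfl; exact hw hu), map_one]

end Portrait

/-! ### Counting -/

section Counting

variable (d : ℕ)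

instance (n : ℕ) : Finite {w : List (Fin d) // w.length < n} :=
  (List.finite_length_lt (Fin d) n).to_subtype

/-- A word of length at most `n` is empty or a letter followed by a word of length less
than `n`. -/
def wordsEquiv (n : ℕ) :
    {w : List (Fin d) // w.length < n + 1} ≃ Option (Fin d × {w : List (Fin d) // w.length < n})
    where
  toFun
    | ⟨[], _⟩ => none
    | ⟨l :: w, h⟩ => some (l, ⟨w, Nat.lt_of_succ_lt_succ h⟩)
  invFun
    | none => ⟨[], Nat.succ_pos n⟩
    | some (l, w) => ⟨l :: w.1, Nat.succ_lt_succ w.2⟩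
  left_inv := by rintro ⟨_ | ⟨l, w⟩, h⟩ <;> rfl
  right_inv := by rintro (_ | ⟨l, w, h⟩) <;> rfl

theorem card_iterWreath_succ (n : ℕ) :
    Nat.card (IterWreath d (n + 1)) = Nat.card (IterWreath d n) ^ d * d.factorial := by
  let := (iterWreathAux d n).2
  change Nat.card (Wreath (iterWreathAux d n).1 d) = Nat.card (iterWreathAux d n).1 ^ d * _
  rw [SemidirectProduct.card, Nat.card_fun, Nat.card_perm]
  simp

/-- Both sides satisfy the same recursion, because there are `1 + d * m` words of length at most `n`
if there are `m` of length less than `n`. Only this order is needed to refute an abstract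
isomorphism. -/
theorem card_portraits (n : ℕ) :
    Nat.card ({w : List (Fin d) // w.length < n} → Equiv.Perm (Fin d)) =
      Nat.card (IterWreath d n) := by
  have h : ∀ m, Nat.card ({w : List (Fin d) // w.length < m} → Equiv.Perm (Fin d)) =
      d.factorial ^ Nat.card {w : List (Fin d) // w.length < m} := by
    intro m
    rw [Nat.card_fun, Nat.card_perm, Nat.card_fin]
  induction n with
  | zero =>
    have : IsEmpty {w : List (Fin d) // w.length < 0} := ⟨fun w => Nat.not_lt_zero _ w.2⟩
    rw [h, Nat.card_of_isEmpty]
    exact (Nat.card_unique (α := Unit)).symm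
  | succ n ih =>
    rw [card_iterWreath_succ, ← ih, h, h, Nat.card_congr (wordsEquiv d n), Finite.card_option,
      Nat.card_prod, Nat.card_fin, pow_succ, ← pow_mul, mul_comm d]

end Counting

/-! ### The discriminant of `f - x` -/

open Matrix in
-- Each pair `i < j` contributes `(r i - r j) * (r j - r i)`, minus a square.
theorem prod_prod_sub_eq {R : Type*} [CommRing R] {n : ℕ} (r : Fin n → R) :
    ∏ i, ∏ j ∈ ({i}ᶜ : Finset (Fin n)), (r i - r j) =
      (∏ i : Fin n, ∏ _j ∈ Finset.Ioi i, (-1)) * (vandermonde r).det ^ 2 := by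
  rw [det_vandermonde, ← Finset.prod_pow, ← Finset.prod_mul_distrib,
    ← Finset.prod_prod_Ioi_mul_eq_prod_prod_off_diag (fun j i => r i - r j)]
  refine Finset.prod_congr rfl fun i _ => ?_
  rw [← Finset.prod_pow, ← Finset.prod_mul_distrib]
  exact Finset.prod_congr rfl fun j _ => by ring

section Disc

variable {K Ω : Type*} [Field K] [Field Ω] [IsAlgClosed Ω] [Algebra K Ω]

variable (Ω) in
/-- The critical points of `f`, with multiplicity. -/
noncomputable def crit (f : K[X]) : Multiset Ω :=
  ((derivative f).map (algebraMap K Ω)).roots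

theorem card_crit [CharZero K] (f : K[X]) : (crit Ω f).card = f.natDegree - 1 := by
  rw [crit, ← (IsAlgClosed.splits _).natDegree_eq_card_roots, natDegree_map,
    natDegree_derivative]

/-- The product of the values of `f'` at the roots of `f - x` is computed twice: from the
factorization of `f - x`, and from that of `f'`. It is essential that `C` lies in `K` and does not
depend on `x`. -/
theorem exists_vandermonde_sq [CharZero K] (f : K[X]) (hf : f.natDegree ≠ 0) :
    ∃ C : K, C ≠ 0 ∧ ∀ (x : Ω) (r : Fin f.natDegree → Ω),
      f.map (algebraMap K Ω) - Polynomial.C x =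
        Polynomial.C (algebraMap K Ω f.leadingCoeff) * ∏ i, (X - Polynomial.C (r i)) →
      (Matrix.vandermonde r).det ^ 2 =
        algebraMap K Ω C * ((crit Ω f).map fun c => aeval c f - x).prod := by
  set a := f.leadingCoeff
  set b := (derivative f).leadingCoeff
  set d := f.natDegree
  set ε : K := ∏ i : Fin d, ∏ _j ∈ Finset.Ioi i, (-1)
  have ha : a ≠ 0 := leadingCoeff_ne_zero.2 fun h => hf (by simp [d, h])
  have hb : b ≠ 0 := leadingCoeff_ne_zero.2 fun h => hf (derivative_eq_zero.1 h)
  have hε : ε ≠ 0 := Finset.prod_ne_zero_iff.2 fun i _ => Finset.prod_ne_zero_iff.2 fun _ _ => by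
    simp
  -- Each of the `d` values of `f'` contributes `b`, each critical point contributes `(-1) ^ d / a`
  -- through `h4`, and `a ^ d * ε` is the factor in front of the Vandermonde square.
  refine ⟨b ^ d * ((-1) ^ d / a) ^ (crit Ω f).card / (a ^ d * ε), ?_, fun x r h => ?_⟩
  · have : ((-1) ^ d / a : K) ≠ 0 := div_ne_zero (by simp) ha
    positivity
  have ha' : algebraMap K Ω a ≠ 0 := by simpa using ha
  have hε' : algebraMap K Ω ε ≠ 0 := by simpa using hε
  have h1 : ∀ i, eval (r i) ((derivative f).map (algebraMap K Ω)) =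
      algebraMap K Ω a * ∏ j ∈ ({i}ᶜ : Finset (Fin d)), (r i - r j) := by
    intro i
    have h' := congrArg derivative h
    rw [derivative_sub, derivative_C, sub_zero, derivative_map, derivative_C_mul,
      derivative_prod_finset] at h'
    rw [h', eval_mul, eval_C, eval_finsetSum, Finset.sum_eq_single_of_mem i (Finset.mem_univ i)]
    · simp [eval_prod, Finset.compl_singleton]
    · intro j _ hj
      rw [derivative_X_sub_C, mul_one, eval_prod]
      exact Finset.prod_eq_zero (Finset.mem_erase.2 ⟨hj.symm, Finset.mem_univ i⟩) (by simp)
  have h2 : ∀ y, ∏ i, (y - r i) = (algebraMap K Ω a)⁻¹ * (aeval y f - x) := by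
    intro y
    have h' := congrArg (eval y) h
    rw [eval_sub, eval_C, eval_map_algebraMap, eval_mul, eval_C, eval_prod] at h'
    rw [h', inv_mul_cancel_left₀ ha']
    simp
  have h3 : ∀ y, eval y ((derivative f).map (algebraMap K Ω)) =
      algebraMap K Ω b * ((crit Ω f).map fun c => y - c).prod := by
    intro y
    rw [(IsAlgClosed.splits _).eval_eq_prod_roots, leadingCoeff_map]
    rfl
  have h4 : ∏ i, ((crit Ω f).map fun c => r i - c).prod =
      ((-1) ^ d / algebraMap K Ω a) ^ (crit Ω f).card *
        ((crit Ω f).map fun c => aeval c f - x).prod := by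
    induction crit Ω f using Multiset.induction with
    | empty => simp
    | cons c s ih =>
      have h5 : ∏ i, (r i - c) = (-1) ^ d / algebraMap K Ω a * (aeval c f - x) := by
        rw [div_eq_mul_inv, mul_assoc, ← h2]
        simp_rw [← neg_sub c (r _), ← neg_one_mul (c - r _), Finset.prod_mul_distrib]
        simp
      simp only [Multiset.map_cons, Multiset.prod_cons, Finset.prod_mul_distrib,
        Multiset.card_cons, ih, h5]
      ring
  have hε2 : algebraMap K Ω ε = ∏ i : Fin d, ∏ _j ∈ Finset.Ioi i, (-1) := by
    simp [ε]
  have key : algebraMap K Ω a ^ d * (algebraMap K Ω ε * (Matrix.vandermonde r).det ^ 2) =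
      algebraMap K Ω b ^ d * (((-1) ^ d / algebraMap K Ω a) ^ (crit Ω f).card *
        ((crit Ω f).map fun c => aeval c f - x).prod) := by
    rw [hε2, ← prod_prod_sub_eq, ← h4]
    have hc : ∀ y : Ω, y ^ d = ∏ _i : Fin d, y := by simp
    rw [hc, hc, ← Finset.prod_mul_distrib, ← Finset.prod_mul_distrib]
    exact Finset.prod_congr rfl fun i _ => (h1 i).symm.trans (h3 (r i))
  simp only [map_div₀, map_mul, map_pow, map_neg, map_one]
  rw [div_mul_eq_mul_div, eq_div_iff (by positivity)]
  linear_combination key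

end Disc

/-! ### Sign characters on trees of preimages -/

section Signs

variable {K Ω : Type*} [Field K] [Field Ω] [Algebra K Ω]
  {f : K[X]} {x : List (Fin f.natDegree) → Ω}

/-- The words in `natDegree f` letters carry points of `Ω` in such a way that the children of
`w` carry the roots of `f - x w`. -/
def IsPreimageLabel (f : K[X]) (x : List (Fin f.natDegree) → Ω) : Prop :=
  ∀ w, f.map (algebraMap K Ω) - Polynomial.C (x w) =
    Polynomial.C (algebraMap K Ω f.leadingCoeff) * ∏ i, (X - Polynomial.C (x (i :: w)))

/-- The Vandermonde determinant of the points carried by the children of `w`. -/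
noncomputable def childDet {d : ℕ} (x : List (Fin d) → Ω) (w : List (Fin d)) : Ω :=
  (Matrix.vandermonde fun i => x (i :: w)).det

/-- The product of `childDet` over the `k`-th level below `v`. -/
noncomputable def levelDet {d : ℕ} (x : List (Fin d) → Ω) (v : List (Fin d)) (k : ℕ) : Ω :=
  ∏ w ∈ desc v k, childDet x w

theorem IsPreimageLabel.mul_prod_sub (hx : IsPreimageLabel f x) (w : List (Fin f.natDegree))
    (y : Ω) :
    algebraMap K Ω f.leadingCoeff * ∏ i, (y - x (i :: w)) = aeval y f - x w := by
  have h := congrArg (eval y) (hx w)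
  rw [eval_sub, eval_C, eval_map_algebraMap, eval_mul, eval_C, eval_prod] at h
  rw [h]
  simp

/-- This factors `f^k - x v` over the `k`-th level below `v`; the power of the leading coefficient
of `f` is the leading coefficient of `f^k`. -/
theorem IsPreimageLabel.mul_prod_desc_sub (hx : IsPreimageLabel f x)
    (v : List (Fin f.natDegree)) (k : ℕ) (y : Ω) :
    algebraMap K Ω f.leadingCoeff ^ (∑ i ∈ Finset.range k, f.natDegree ^ i) *
      ∏ u ∈ desc v k, (y - x u) = (fun z => aeval z f)^[k] y - x v := by
  induction k generalizing y with
  | zero => simp [desc]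
  | succ k ih =>
    rw [Function.iterate_succ_apply, ← ih, Finset.sum_range_succ, pow_add, mul_assoc,
      prod_desc_succ, ← card_desc v k, ← Finset.prod_const, ← Finset.prod_mul_distrib]
    simp_rw [hx.mul_prod_sub]

/-- Multiplying the discriminant formula over a level and exchanging products leaves, for each `c`,
the factorization of `f^k - x v` evaluated at `f(c)`. The constant `C` is an argument so that
different levels can share it. -/
theorem IsPreimageLabel.levelDet_sq [CharZero K] [IsAlgClosed Ω]
    (hx : IsPreimageLabel f x) (hf : f.natDegree ≠ 0) {C : K}
    (hC : ∀ (x : Ω) (r : Fin f.natDegree → Ω),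
      f.map (algebraMap K Ω) - Polynomial.C x =
        Polynomial.C (algebraMap K Ω f.leadingCoeff) * ∏ i, (X - Polynomial.C (r i)) →
      (Matrix.vandermonde r).det ^ 2 =
        algebraMap K Ω C * ((crit Ω f).map fun c => aeval c f - x).prod)
    (v : List (Fin f.natDegree)) (k : ℕ) :
    algebraMap K Ω f.leadingCoeff ^ f.natDegree ^ k * levelDet x v k ^ 2 =
      algebraMap K Ω C ^ f.natDegree ^ k * algebraMap K Ω f.leadingCoeff *
        ((crit Ω f).map fun c => (fun z => aeval z f)^[k + 1] c - x v).prod := by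
  set a := algebraMap K Ω f.leadingCoeff
  have h1 : levelDet x v k ^ 2 = algebraMap K Ω C ^ f.natDegree ^ k *
      ((crit Ω f).map fun c => ∏ u ∈ desc v k, (aeval c f - x u)).prod := by
    rw [levelDet, ← Finset.prod_pow]
    have : ∀ u ∈ desc v k, childDet x u ^ 2 =
        algebraMap K Ω C * ((crit Ω f).map fun c => aeval c f - x u).prod :=
      fun u _ => hC (x u) _ (hx u)
    rw [Finset.prod_congr rfl this, Finset.prod_mul_distrib, Finset.prod_const, card_desc]
    congr 1
    exact (Multiset.prod_map_prod_map _ _).symm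
  -- This is `(d - 1) * (1 + d + ⋯ + d ^ (k - 1)) = d ^ k - 1` in the exponent.
  have h2 : a ^ f.natDegree ^ k =
      a * (a ^ (∑ i ∈ Finset.range k, f.natDegree ^ i)) ^ (crit Ω f).card := by
    rw [card_crit, ← pow_mul, ← pow_succ']
    congr 1
    obtain ⟨m, hm⟩ := Nat.exists_eq_succ_of_ne_zero hf
    rw [hm, Nat.succ_sub_one]
    exact (geom_sum_mul_add m k).symm
  have h3 : ((crit Ω f).map fun c => (fun z => aeval z f)^[k + 1] c - x v).prod =
      (a ^ (∑ i ∈ Finset.range k, f.natDegree ^ i)) ^ (crit Ω f).card *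
        ((crit Ω f).map fun c => ∏ u ∈ desc v k, (aeval c f - x u)).prod := by
    rw [← Multiset.prod_replicate, ← Multiset.map_const', ← Multiset.prod_map_mul]
    congr 1
    refine Multiset.map_congr rfl fun c _ => ?_
    rw [Function.iterate_succ_apply, hx.mul_prod_desc_sub]
  rw [h1, h3, h2]
  ring

/-- Applying `σ` turns the Vandermonde matrix at `w` into the one at `g w` with rows permuted by the
portrait. -/
theorem map_childDet {d : ℕ} {x : List (Fin d) → Ω} {σ : Ω ≃ₐ[K] Ω} {g : AutTree d}
    (hg : ∀ w, x (g.1 w) = σ (x w)) (w : List (Fin d)) :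
    σ (childDet x w) = ((Equiv.Perm.sign (portrait g w) : ℤ) : Ω) * childDet x (g.1 w) := by
  rw [childDet, childDet, ← Matrix.det_permute, AlgEquiv.map_det]
  congr 1
  ext i j
  simp only [AlgEquiv.mapMatrix_apply, Matrix.map_apply, Matrix.vandermonde_apply,
    Matrix.submatrix_apply, map_pow, id]
  rw [← hg, apply_cons]

theorem map_levelDet {d : ℕ} {x : List (Fin d) → Ω} {σ : Ω ≃ₐ[K] Ω} {g : AutTree d}
    (hg : ∀ w, x (g.1 w) = σ (x w)) {v : List (Fin d)} (hv : g.1 v = v) (k : ℕ) :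
    σ (levelDet x v k) = ((levelSign g v k : ℤ) : Ω) * levelDet x v k := by
  rw [levelDet, map_prod, Finset.prod_congr rfl fun w _ => map_childDet hg w,
    Finset.prod_mul_distrib, levelSign, Units.coe_prod, Int.cast_prod]
  congr 1
  exact Finset.prod_equiv g.1 (fun _ => apply_mem_desc_iff hv) fun _ _ => rfl

/-- If the critical orbits agree at the steps `k + 1` and `l + 1`, then the sign characters at the
levels `k` and `l` agree on Galois automorphisms. -/
theorem IsPreimageLabel.levelSign_eq [CharZero K] [IsAlgClosed Ω]
    (hx : IsPreimageLabel f x) (hf : f.natDegree ≠ 0)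
    {σ : Ω ≃ₐ[K] Ω} {g : AutTree f.natDegree} (hg : ∀ w, x (g.1 w) = σ (x w))
    {v : List (Fin f.natDegree)} (hv : g.1 v = v) {k l : ℕ} (hk : k ≠ 0) (hl : l ≠ 0)
    (hkl : ∀ c ∈ crit Ω f, (fun z => aeval z f)^[k + 1] c = (fun z => aeval z f)^[l + 1] c)
    (hk0 : levelDet x v k ≠ 0) : levelSign g v k = levelSign g v l := by
  have : CharZero Ω := charZero_of_injective_algebraMap (algebraMap K Ω).injective
  obtain ⟨C, hC0, hC⟩ := exists_vandermonde_sq (Ω := Ω) f hf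
  have ha0 : f.leadingCoeff ≠ 0 := leadingCoeff_ne_zero.2 fun h => hf (by simp [h])
  have hEk := hx.levelDet_sq hf hC v k
  have hEl := hx.levelDet_sq hf hC v l
  rw [Multiset.map_congr rfl fun c hc => congrArg (· - x v) (hkl c hc)] at hEk
  generalize f.leadingCoeff = a at ha0 hEk hEl
  -- As `k` and `l` are nonzero, both powers have the parity of `d`; this makes the factor between
  -- the two squares a square in `K`.
  obtain ⟨m, hm⟩ : Even (f.natDegree ^ k + f.natDegree ^ l) := by
    rw [Nat.even_add, Nat.even_pow' hk, Nat.even_pow' hl]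
  have hsq : (algebraMap K Ω (a ^ f.natDegree ^ k * C ^ f.natDegree ^ l) * levelDet x v k) ^ 2 =
      (algebraMap K Ω ((a * C) ^ m) * levelDet x v l) ^ 2 := by
    have h1 : ((algebraMap K Ω ((a * C) ^ m)) ^ 2) =
        algebraMap K Ω a ^ f.natDegree ^ k * algebraMap K Ω C ^ f.natDegree ^ l *
          (algebraMap K Ω a ^ f.natDegree ^ l * algebraMap K Ω C ^ f.natDegree ^ k) := by
      rw [← map_pow, ← pow_mul, mul_two, ← hm]
      simp only [map_mul, map_pow]
      ring
    rw [mul_pow, mul_pow, h1, map_mul, map_pow, map_pow]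
    linear_combination (algebraMap K Ω a ^ f.natDegree ^ k * (algebraMap K Ω C ^ f.natDegree ^ l) ^ 2) * hEk -
      algebraMap K Ω a ^ f.natDegree ^ k * algebraMap K Ω C ^ f.natDegree ^ l * algebraMap K Ω C ^ f.natDegree ^ k * hEl
  have hne : algebraMap K Ω (a ^ f.natDegree ^ k * C ^ f.natDegree ^ l) * levelDet x v k ≠ 0 :=
    mul_ne_zero ((_root_.map_ne_zero _).2 (mul_ne_zero (pow_ne_zero _ ha0) (pow_ne_zero _ hC0))) hk0
  -- The ratio lies in `K` although `x v` need not, since the factors involving `x v` have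
  -- cancelled. Hence `σ` fixes it.
  obtain ⟨q, hq⟩ : ∃ q : K, algebraMap K Ω (a ^ f.natDegree ^ k * C ^ f.natDegree ^ l) * levelDet x v k =
      algebraMap K Ω q * levelDet x v l := by
    rcases sq_eq_sq_iff_eq_or_eq_neg.1 hsq with h | h
    · exact ⟨_, h⟩
    · exact ⟨-(a * C) ^ m, by rw [h, map_neg, neg_mul]⟩
  have hσ := congrArg σ hq
  rw [map_mul σ, map_mul σ, σ.commutes, σ.commutes, map_levelDet hg hv, map_levelDet hg hv,
    mul_left_comm, mul_left_comm (algebraMap K Ω q), ← hq] at hσ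
  exact Units.ext (Int.cast_injective (mul_right_cancel₀ hne hσ))

/-- If the orbits of all critical points are finite, then infinitely many steps of all critical
orbits agree. -/
theorem exists_infinite_iterate_eq {S : Type*} {s : Multiset S} {F : S → S}
    (h : ∀ c ∈ s, (Set.range fun n : ℕ => F^[n] c).Finite) :
    ∃ T : Set ℕ, T.Infinite ∧ (∀ k ∈ T, k ≠ 0) ∧
      ∀ k ∈ T, ∀ l ∈ T, ∀ c ∈ s, F^[k + 1] c = F^[l + 1] c := by
  classical
  let O : Set ((c : {c // c ∈ s.toFinset}) → S) :=
    Set.pi Set.univ fun c => Set.range fun n : ℕ => F^[n] c.1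
  have hO : O.Finite := Set.Finite.pi fun c => h c.1 (Multiset.mem_toFinset.1 c.2)
  have := hO.to_subtype
  -- Pigeonhole on the tuple of all critical orbits. The shift by 2 corresponds to the step `(k + 1)
  -- + 1` of the positive index `k + 1`.
  let φ : ℕ → O := fun k => ⟨fun c => F^[k + 2] c.1, fun c _ => ⟨k + 2, rfl⟩⟩
  obtain ⟨y, hy⟩ := Finite.exists_infinite_fiber φ
  refine ⟨Nat.succ '' (φ ⁻¹' {y}), (Set.infinite_coe_iff.1 hy).image Nat.succ_injective.injOn,
    ?_, ?_⟩
  · rintro _ ⟨k, _, rfl⟩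
    exact Nat.succ_ne_zero k
  · rintro _ ⟨k, hk, rfl⟩ _ ⟨l, hl, rfl⟩ c hc
    have hkl : φ k = φ l := Eq.trans hk hl.symm
    exact congrFun (congrArg Subtype.val hkl) ⟨c, Multiset.mem_toFinset.2 hc⟩

end Signs

/-! ### Labelings of the tree of preimages -/

section Labelings

variable {K : Type*} [Field K] {f : K[X]} {α : K} (e : Labeling f α)

theorem Labeling.parent_symm (w : List (Fin f.natDegree)) :
    parent (e.toEquiv.symm w) = e.toEquiv.symm w.tail := by
  rw [Equiv.eq_symm_apply, e.map_parent, Equiv.apply_symm_apply]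

theorem Labeling.exists_symm_cons (l : Fin f.natDegree) (w : List (Fin f.natDegree)) :
    ∃ p, (e.toEquiv.symm (l :: w)).1 = p :: (e.toEquiv.symm w).1 := by
  have h : parent (e.toEquiv.symm (l :: w)) = e.toEquiv.symm w := e.parent_symm (l :: w)
  rcases hv : (e.toEquiv.symm (l :: w)).1 with _ | ⟨p, u⟩
  · have h' : parent (e.toEquiv.symm (l :: w)) = e.toEquiv.symm (l :: w) := Subtype.ext (by
      change (e.toEquiv.symm (l :: w)).1.tail = (e.toEquiv.symm (l :: w)).1
      rw [hv, List.tail_nil])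
    have := e.toEquiv.symm.injective (h'.symm.trans h)
    exact absurd (congrArg List.length this) (by simp)
  · refine ⟨p, ?_⟩
    rw [← h]
    change _ = p :: (e.toEquiv.symm (l :: w)).1.tail
    rw [hv, List.tail_cons]

/-- The last step of the vertex labeled `l :: w`. -/
noncomputable def Labeling.step (l : Fin f.natDegree) (w : List (Fin f.natDegree)) :
    AlgebraicClosure K × ℕ :=
  (e.exists_symm_cons l w).choose

theorem Labeling.symm_cons (l : Fin f.natDegree) (w : List (Fin f.natDegree)) :
    (e.toEquiv.symm (l :: w)).1 = e.step l w :: (e.toEquiv.symm w).1 :=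
  (e.exists_symm_cons l w).choose_spec

/-- The point carried by the vertex with label `w`. -/
noncomputable def Labeling.labelPoint (w : List (Fin f.natDegree)) : AlgebraicClosure K :=
  point α (e.toEquiv.symm w).1

theorem Labeling.labelPoint_cons (l : Fin f.natDegree) (w : List (Fin f.natDegree)) :
    e.labelPoint (l :: w) = (e.step l w).1 := by
  rw [labelPoint, e.symm_cons]
  rfl

theorem Labeling.labelPoint_nil : e.labelPoint [] = algebraMap K (AlgebraicClosure K) α := by
  have h := e.parent_symm []
  rw [labelPoint]
  rcases hv : (e.toEquiv.symm []).1 with _ | ⟨p, u⟩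
  · rfl
  · have h' : (e.toEquiv.symm []).1.tail = (e.toEquiv.symm []).1 := congrArg Subtype.val h
    rw [hv, List.tail_cons] at h'
    exact absurd (congrArg List.length h') (by simp)

theorem Labeling.step_injective (w : List (Fin f.natDegree)) :
    Function.Injective fun l => e.step l w := by
  intro l l' h
  have : e.toEquiv.symm (l :: w) = e.toEquiv.symm (l' :: w) := Subtype.ext (by
    rw [e.symm_cons, e.symm_cons]
    exact congrArg (· :: _) h)
  exact (List.cons.inj (e.toEquiv.symm.injective this)).1

theorem Labeling.step_lt (l : Fin f.natDegree) (w : List (Fin f.natDegree)) :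
    (e.step l w).2 < rootMultiplicity (e.step l w).1
      (f.map (algebraMap K (AlgebraicClosure K)) - C (e.labelPoint w)) := by
  have h := (e.toEquiv.symm (l :: w)).2
  rw [e.symm_cons] at h
  exact h.2

theorem Labeling.exists_step_eq (w : List (Fin f.natDegree)) (p : AlgebraicClosure K × ℕ)
    (hp : p.2 < rootMultiplicity p.1
      (f.map (algebraMap K (AlgebraicClosure K)) - C (e.labelPoint w))) :
    ∃ l, e.step l w = p := by
  let V : PreimageTree f α := ⟨p :: (e.toEquiv.symm w).1, (e.toEquiv.symm w).2, hp⟩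
  have hV : (e.toEquiv V).tail = w := by
    rw [← e.map_parent, ← Equiv.eq_symm_apply]
    rfl
  rcases hu : e.toEquiv V with _ | ⟨l, u⟩
  · have hw : w = [] := by rw [← hV, hu, List.tail_nil]
    have h2 : e.toEquiv V = w := by rw [hu, hw]
    rw [← Equiv.eq_symm_apply] at h2
    exact absurd (congrArg (fun v => v.1.length) h2) (by simp [V])
  · rw [hu, List.tail_cons] at hV
    subst hV
    refine ⟨l, ?_⟩
    have h3 := e.symm_cons l u
    rw [← hu, Equiv.symm_apply_apply] at h3
    exact (List.cons.inj h3).1.symm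

/-- The steps at `w` run exactly once through the pairs (root, copy index), so forgetting the index
gives the roots with multiplicity. -/
theorem Labeling.isPreimageLabel (hf : f.natDegree ≠ 0) : IsPreimageLabel f e.labelPoint := by
  classical
  intro w
  have hstep := e.step_lt (w := w)
  have hex := e.exists_step_eq w
  set g := f.map (algebraMap K (AlgebraicClosure K)) - C (e.labelPoint w) with hg
  have hlead : g.leadingCoeff = algebraMap K (AlgebraicClosure K) f.leadingCoeff := by
    rw [hg, leadingCoeff_sub_of_degree_lt, leadingCoeff_map]
    refine degree_C_le.trans_lt ?_
    rw [degree_map]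
    exact natDegree_pos_iff_degree_pos.1 (Nat.pos_of_ne_zero hf)
  have hroots : g.roots = Finset.univ.val.map fun l => e.labelPoint (l :: w) := by
    have h : g.roots.toEnumFinset =
        Finset.univ.map ⟨fun l => e.step l w, e.step_injective w⟩ := by
      ext p
      rw [Multiset.mem_toEnumFinset, count_roots]
      simp only [Finset.mem_map, Finset.mem_univ, true_and]
      exact ⟨hex p, fun ⟨l, hl⟩ => hl ▸ hstep l⟩
    rw [← g.roots.map_toEnumFinset_fst, h, Finset.map_val, Multiset.map_map]
    exact Multiset.map_congr rfl fun l _ => (e.labelPoint_cons l w).symm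
  rw [(IsAlgClosed.splits g).eq_prod_roots, hlead, hroots, Multiset.map_map]
  rfl

theorem labelPoint_arborealRep (σ : Gal(AlgebraicClosure K/K)) (w : List (Fin f.natDegree)) :
    e.labelPoint ((arborealRep e σ).1 w) = σ (e.labelPoint w) := by
  rw [Labeling.labelPoint, Labeling.labelPoint, ← point_galWord]
  congr 1
  change (e.toEquiv.symm (e.toEquiv (galPerm f α σ (e.toEquiv.symm w)))).1 = _
  rw [Equiv.symm_apply_apply]
  rfl

theorem step_arborealRep (σ : Gal(AlgebraicClosure K/K)) (l : Fin f.natDegree)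
    (w : List (Fin f.natDegree)) :
    e.step (portrait (arborealRep e σ) w l) ((arborealRep e σ).1 w) =
      (σ (e.step l w).1, (e.step l w).2) := by
  have h : (e.toEquiv.symm ((arborealRep e σ).1 (l :: w))).1 =
      galWord σ (e.toEquiv.symm (l :: w)).1 := by
    change (e.toEquiv.symm (e.toEquiv (galPerm f α σ (e.toEquiv.symm (l :: w))))).1 = _
    rw [Equiv.symm_apply_apply]
    rfl
  rw [apply_cons, e.symm_cons, e.symm_cons] at h
  exact (List.cons.inj h).1

/-- A Galois automorphism does not interchange two copies of the same preimage. -/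
theorem portrait_arborealRep_ne (σ : Gal(AlgebraicClosure K/K)) {w : List (Fin f.natDegree)}
    (hw : (arborealRep e σ).1 w = w) {l l' : Fin f.natDegree} (hl : l ≠ l')
    (h : e.labelPoint (l :: w) = e.labelPoint (l' :: w)) :
    portrait (arborealRep e σ) w ≠ Equiv.swap l l' := by
  intro hp
  have h1 := step_arborealRep e σ l w
  rw [hw, hp, Equiv.swap_apply_left] at h1
  refine hl (e.step_injective w (Prod.ext ?_ (congrArg Prod.snd h1).symm))
  change (e.step l w).1 = (e.step l' w).1
  rw [← e.labelPoint_cons, ← e.labelPoint_cons, h]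

/-- If `childDet` vanishes at `w`, then two children of `w` carry the same point. -/
theorem exists_eq_of_childDet_eq_zero {d : ℕ} {Ω : Type*} [Field Ω] {x : List (Fin d) → Ω}
    {w : List (Fin d)} (h : childDet x w = 0) :
    ∃ l l' : Fin d, l ≠ l' ∧ x (l :: w) = x (l' :: w) := by
  obtain ⟨l, l', h1, h2⟩ := Matrix.det_vandermonde_eq_zero_iff.1 h
  exact ⟨l, l', h2, h1⟩

theorem aeval_iter {Ω : Type*} [Field Ω] [Algebra K Ω] (f : K[X]) (n : ℕ) (y : Ω) :
    aeval y (iter f n) = (fun z => aeval z f)^[n] y := by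
  induction n generalizing y with
  | zero => simp [iter]
  | succ n ih =>
    have : iter f (n + 1) = f.comp (iter f n) := Function.iterate_succ_apply' _ _ _
    rw [this, aeval_comp, ih, Function.iterate_succ_apply']

/-- At a root of `f^n - α`, some factor of the product over the `n`-th level must vanish. -/
theorem Labeling.exists_labelPoint_eq (hf : f.natDegree ≠ 0) (n : ℕ) {y : AlgebraicClosure K}
    (hy : aeval y (iter f n - C α) = 0) :
    ∃ w : List (Fin f.natDegree), w.length = n ∧ e.labelPoint w = y := by
  have h := (e.isPreimageLabel hf).mul_prod_desc_sub [] n y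
  have ha : algebraMap K (AlgebraicClosure K) f.leadingCoeff ≠ 0 :=
    (_root_.map_ne_zero _).2 (leadingCoeff_ne_zero.2 fun h => hf (by simp [h]))
  rw [map_sub, aeval_C] at hy
  rw [← aeval_iter, e.labelPoint_nil, hy, mul_eq_zero, or_iff_right (pow_ne_zero _ ha),
    Finset.prod_eq_zero_iff] at h
  obtain ⟨w, hw, h⟩ := h
  exact ⟨w, by simpa using length_of_mem_desc hw, (sub_eq_zero.1 h).symm⟩

/-- Galois automorphisms with the same portrait up to depth `n` have the same image in the `n`-th
dynamical Galois group. -/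
theorem restrict_eq_of_portrait_eq (hf : f.natDegree ≠ 0) (n : ℕ)
    [Fact ((iter f n - C α).map (algebraMap K (AlgebraicClosure K))).Splits]
    {σ τ : Gal(AlgebraicClosure K/K)}
    (h : ∀ w : List (Fin f.natDegree), w.length < n →
      portrait (arborealRep e σ) w = portrait (arborealRep e τ) w) :
    Gal.restrict (iter f n - C α) (AlgebraicClosure K) σ =
      Gal.restrict (iter f n - C α) (AlgebraicClosure K) τ := by
  refine Gal.galActionHom_injective _ (AlgebraicClosure K) (Equiv.ext fun y => Subtype.ext ?_)
  rw [Gal.galActionHom_restrict, Gal.galActionHom_restrict]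
  obtain ⟨w, hw, hy⟩ := e.exists_labelPoint_eq hf n (aeval_eq_zero_of_mem_rootSet y.2)
  rw [← hy, ← labelPoint_arborealRep, ← labelPoint_arborealRep,
    apply_eq_of_portrait_eq h w hw.le]

/-- If not every portrait of depth `n` is that of a Galois automorphism, then the `n`-th dynamical
Galois group is not the full iterated wreath product. -/
theorem isEmpty_dynGal_mulEquiv (hf : f.natDegree ≠ 0) {n : ℕ}
    (g : AutTree f.natDegree)
    (hg : ∀ σ, ∃ w : List (Fin f.natDegree), w.length < n ∧
      portrait (arborealRep e σ) w ≠ portrait g w) :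
    IsEmpty (DynGal f α n ≃* IterWreath f.natDegree n) := by
  have : Fact ((iter f n - C α).map (algebraMap K (AlgebraicClosure K))).Splits :=
    ⟨IsAlgClosed.splits _⟩
  refine ⟨fun φ => ?_⟩
  choose lift hlift using Gal.restrict_surjective (iter f n - C α) (AlgebraicClosure K)
  let F : DynGal f α n → ({w : List (Fin f.natDegree) // w.length < n} →
      Equiv.Perm (Fin f.natDegree)) := fun τ w => portrait (arborealRep e (lift τ)) w.1
  have hF : Function.Injective F := fun τ τ' h => by
    rw [← hlift τ, ← hlift τ']
    exact restrict_eq_of_portrait_eq e hf n fun w hw => congrFun h ⟨w, hw⟩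
  -- `F` depends on chosen lifts and need not be multiplicative; being injective between finite sets
  -- of equal size, it would still hit the portrait of `g`.
  have hcard := (Nat.card_congr φ.toEquiv).trans (card_portraits f.natDegree n).symm
  have : Finite (DynGal f α n) := Finite.of_injective F hF
  obtain ⟨τ, hτ⟩ := ((Nat.bijective_iff_injective_and_card F).2 ⟨hF, hcard⟩).2
    fun w => portrait g w.1
  obtain ⟨w, hw, hne⟩ := hg (lift τ)
  exact hne (congrFun hτ ⟨w, hw⟩)

/-! ### The main result -/

theorem IsPCF.finite_range (hf : IsPCF f) {c : AlgebraicClosure K}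
    (hc : c ∈ crit (AlgebraicClosure K) f) :
    (Set.range fun n : ℕ => (fun z : AlgebraicClosure K => aeval z f)^[n] c).Finite := by
  refine hf c ?_
  rw [← eval_map_algebraMap]
  exact (mem_roots'.1 hc).2

/-- A subgroup has infinite index if it contains no quotient of two different terms of some
sequence. -/
theorem not_finiteIndex_of_inv_mul_notMem {G : Type*} [Group G] {H : Subgroup G} (g : ℕ → G)
    (hg : ∀ i j, i < j → (g i)⁻¹ * g j ∉ H) : ¬ H.FiniteIndex := by
  intro hH
  have : Finite (G ⧸ H) := H.finite_quotient_of_finiteIndex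
  obtain ⟨i, j, hij, h⟩ := Finite.exists_ne_map_eq_of_infinite fun i => (g i : G ⧸ H)
  rcases hij.lt_or_gt with hlt | hlt
  · exact hg i j hlt (QuotientGroup.eq.1 h)
  · exact hg j i hlt (QuotientGroup.eq.1 h.symm)

/-- Two levels `k < l` are chosen from the critical orbits alone, so `N = l + 1` serves every `α`.
The missed portrait is a swap of two copies of a multiple root if one occurs up to depth `l`, and
otherwise a transposition on level `l`, with signs `1` at `k` and `-1` at `l`. -/
theorem exists_isEmpty_dynGal_mulEquiv [CharZero K] (hdeg : 2 ≤ f.natDegree) (hf : IsPCF f) :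
    ∃ N : ℕ, ∀ α : K, IsEmpty (DynGal f α N ≃* IterWreath f.natDegree N) := by
  obtain ⟨T, hT, hT0, hTeq⟩ := exists_infinite_iterate_eq fun c => hf.finite_range (c := c)
  obtain ⟨k, hk⟩ := hT.nonempty
  obtain ⟨l, hl, hkl⟩ := hT.exists_gt k
  have hd : f.natDegree ≠ 0 := by omega
  let z : Fin f.natDegree := ⟨0, by omega⟩
  let z' : Fin f.natDegree := ⟨1, by omega⟩
  have hz : z ≠ z' := by simp [z, z']
  refine ⟨l + 1, fun α => ?_⟩
  obtain ⟨e⟩ := nonempty_labeling f α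
  by_cases h0 : ∃ w : List (Fin f.natDegree), w.length < l + 1 ∧ childDet e.labelPoint w = 0
  · obtain ⟨w, hw, hw0⟩ := h0
    obtain ⟨i, j, hij, h⟩ := exists_eq_of_childDet_eq_zero hw0
    refine isEmpty_dynGal_mulEquiv e hd (rotate w (Equiv.swap i j)) fun σ => ?_
    by_contra! hσ
    refine portrait_arborealRep_ne e σ (w := w) ?_ hij h
      ((hσ w hw).trans (portrait_rotate_self _ _))
    rw [apply_eq_of_portrait_eq hσ w hw.le]
    exact rotate_apply_of_length_le le_rfl _
  · push Not at h0
    let w : List (Fin f.natDegree) := List.replicate l z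
    have hw : w ∈ desc [] l := by
      simpa [w] using append_mem_desc [] w
    refine isEmpty_dynGal_mulEquiv e hd (rotate w (Equiv.swap z z')) fun σ => ?_
    by_contra! hσ
    have hlev : ∀ m ≤ l, levelSign (arborealRep e σ) [] m =
        levelSign (rotate w (Equiv.swap z z')) [] m := fun m hm =>
      Finset.prod_congr rfl fun u hu => by
        rw [hσ u (by rw [length_of_mem_desc hu]; simp; omega)]
    have h1 := (e.isPreimageLabel hd).levelSign_eq hd (labelPoint_arborealRep e σ)
      (autTree_nil _) (hT0 k hk) (hT0 l hl) (hTeq k hk l hl)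
      (Finset.prod_ne_zero_iff.2 fun u hu => h0 u (by
        rw [length_of_mem_desc hu]; simp; omega))
    rw [hlev k hkl.le, hlev l le_rfl, levelSign_rotate_self hw, Equiv.Perm.sign_swap hz,
      levelSign_rotate_of_notMem fun h => by
        have := (length_of_mem_desc h).symm.trans (length_of_mem_desc hw)
        simp at this
        omega] at h1
    exact absurd h1 (by decide)

theorem not_finiteIndex_arborealImage [CharZero K] (hdeg : 2 ≤ f.natDegree) (hf : IsPCF f)
    (e : Labeling f α) : ¬ (arborealImage e).FiniteIndex := by
  have hd : f.natDegree ≠ 0 := by omega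
  let z : Fin f.natDegree := ⟨0, by omega⟩
  let z' : Fin f.natDegree := ⟨1, by omega⟩
  have hz : z ≠ z' := by simp [z, z']
  by_cases h0 : ∃ v : List (Fin f.natDegree), ∀ k, ∀ w ∈ desc v k, childDet e.labelPoint w ≠ 0
  · obtain ⟨v, hv⟩ := h0
    obtain ⟨T, hT, hT0, hTeq⟩ := exists_infinite_iterate_eq fun c => hf.finite_range (c := c)
    -- Level `t 0` is kept as a reference where every `g i` has sign `1`; the transposition of `g i`
    -- sits on level `t (i + 1)`. So the quotient of `g i` and `g j` has different signs on levels
    -- `t 0` and `t (j + 1)`.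
    let t := Nat.nth (· ∈ T)
    have ht : StrictMono t := Nat.nth_strictMono hT
    have htT : ∀ n, t n ∈ T := Nat.nth_mem_of_infinite hT
    let w : ℕ → List (Fin f.natDegree) := fun i => List.replicate (t (i + 1)) z ++ v
    have hw : ∀ i, w i ∈ desc v (t (i + 1)) := fun i => by
      simpa [w] using append_mem_desc v (List.replicate (t (i + 1)) z)
    have hwn : ∀ i n, t (i + 1) ≠ n → w i ∉ desc v n := fun i n hin h => by
      have := (length_of_mem_desc h).symm.trans (length_of_mem_desc (hw i))
      omega
    let g : ℕ → AutTree f.natDegree := fun i => rotate (w i) (Equiv.swap z z')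
    have hg : ∀ i, (g i).1 v = v := fun i =>
      rotate_apply_of_length_le (by rw [length_of_mem_desc (hw i)]; omega) _
    refine not_finiteIndex_of_inv_mul_notMem g fun i j hij => ?_
    rintro ⟨σ, hσ⟩
    have hσ' : g j = g i * arborealRep e σ := by rw [hσ, mul_inv_cancel_left]
    have hσv : (arborealRep e σ).1 v = v := by
      refine (g i).1.injective ?_
      rw [hg]
      have := hg j
      rwa [hσ'] at this
    have h1 := (e.isPreimageLabel hd).levelSign_eq hd (labelPoint_arborealRep e σ) hσv
      (hT0 _ (htT 0)) (hT0 _ (htT (j + 1))) (hTeq _ (htT 0) _ (htT (j + 1)))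
      (Finset.prod_ne_zero_iff.2 fun u hu => hv _ u hu)
    have h2 : ∀ n, levelSign (g j) v n = levelSign (g i) v n *
        levelSign (arborealRep e σ) v n := fun n => by
      rw [hσ', levelSign_mul _ hσv]
    have h3 := h2 (t 0)
    have h4 := h2 (t (j + 1))
    rw [levelSign_rotate_of_notMem (hwn j _ (ht.injective.ne (by omega))),
      levelSign_rotate_of_notMem (hwn i _ (ht.injective.ne (by omega))), one_mul] at h3
    rw [levelSign_rotate_self (hw j),
      levelSign_rotate_of_notMem (hwn i _ (ht.injective.ne (by omega))), one_mul, ← h1, ← h3,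
      Equiv.Perm.sign_swap hz] at h4
    exact absurd h4 (by decide)
  -- Now every vertex has a ramified vertex at or below it, which provides ramified vertices on
  -- strictly increasing levels.
  · push Not at h0
    have hex : ∀ n : ℕ, ∃ w : List (Fin f.natDegree), n < w.length ∧
        childDet e.labelPoint w = 0 := fun n => by
      obtain ⟨k, w, hw, hw0⟩ := h0 (List.replicate (n + 1) z)
      exact ⟨w, by rw [length_of_mem_desc hw, List.length_replicate]; omega, hw0⟩
    choose next hnext hnext0 using hex
    let w : ℕ → List (Fin f.natDegree) := fun n => (fun u => next u.length)^[n + 1] []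
    have hws : ∀ n, w (n + 1) = next (w n).length := fun n =>
      Function.iterate_succ_apply' _ _ _
    have hw0 : ∀ n, childDet e.labelPoint (w n) = 0
      | 0 => hnext0 _
      | n + 1 => by rw [hws]; exact hnext0 _
    have hmono : StrictMono fun n => (w n).length :=
      strictMono_nat_of_lt_succ fun n => by rw [hws]; exact hnext _
    choose l l' hl hll' using fun n => exists_eq_of_childDet_eq_zero (hw0 n)
    -- With inverses the relation reads `arborealRep e σ * rotate (w j) _ = rotate (w i) _`. The
    -- rotation at the deeper `w j` is invisible at `w i`, so `σ` would swap two copies of one root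
    -- there.
    refine not_finiteIndex_of_inv_mul_notMem
      (fun n => (rotate (w n) (Equiv.swap (l n) (l' n)))⁻¹) fun i j hij => ?_
    rw [inv_inv]
    rintro ⟨σ, hσ⟩
    have hlen : (w i).length < (w j).length := hmono hij
    have hne : w i ≠ w j := fun h => by rw [h] at hlen; exact lt_irrefl _ hlen
    have hσ' : arborealRep e σ * rotate (w j) (Equiv.swap (l j) (l' j)) =
        rotate (w i) (Equiv.swap (l i) (l' i)) := by
      rw [hσ, inv_mul_cancel_right]
    have hwj := rotate_apply_of_length_le hlen.le (Equiv.swap (l j) (l' j))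
    have hfix : (arborealRep e σ).1 (w i) = w i := by
      have h1 := rotate_apply_of_length_le (le_refl (w i).length) (Equiv.swap (l i) (l' i))
      rw [← hσ'] at h1
      change (arborealRep e σ).1 ((rotate (w j) (Equiv.swap (l j) (l' j))).1 (w i)) = w i at h1
      rwa [hwj] at h1
    refine portrait_arborealRep_ne e σ hfix (hl i) (hll' i) ?_
    have h2 := portrait_mul (arborealRep e σ) (rotate (w j) (Equiv.swap (l j) (l' j))) (w i)
    rw [hσ', portrait_rotate_self, hwj, portrait_rotate_of_ne hne, mul_one] at h2
    exact h2.symm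

end Labelings

end Arboreal

theorem mainTheorem4 {K : Type*} [Field K] [NumberField K] (f : K[X])
    (hdeg : 2 ≤ f.natDegree) (hf : Arboreal.IsPCF f) :
    (∃ N : ℕ, ∀ α : K,
      IsEmpty (Arboreal.DynGal f α N ≃* Arboreal.IterWreath f.natDegree N)) ∧
    (∀ (α : K) (e : Arboreal.Labeling f α), ¬ (Arboreal.arborealImage e).FiniteIndex) :=
  ⟨Arboreal.exists_isEmpty_dynGal_mulEquiv hdeg hf,
    fun _ e => Arboreal.not_finiteIndex_arborealImage hdeg hf e⟩
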